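/- Let $X$ be a real vector lattice. A linear topology $\tau$ on $X$ is *locally solid* if it has a base at zero of solid sets; such a $\tau$ is *Lebesgue* if every net that order converges to $0$ also $\tau$-converges to $0$. For a locally solid $\tau$, let $u\tau$ be the (locally solid) topology in which $x_\alpha\to x$ if and only if $|x_\alpha-x|\wedge w\xrightarrow{\tau}0$ for every $w\in X_+$; $\tau$ is *unbounded* if $\tau=u\tau$. Lebesgue topologies and unbounded topologies are locally solid by definition. Here a net $(x_\alpha)$ order converges to $0$ if there is a net $(y_\beta)$, possibly over a different index set, with $y_\beta\downarrow 0$ such that for each $\beta$ there is $\alpha_0$ with $|x_\alpha|\le y_\beta$ for all $\alpha\ge\alpha_0$. Let $X^u$ denote the universal completion of $X$, that is, a universally complete (order complete and laterally complete) vector lattice that contains $X$ as an order dense vector sublattice. A topology on $X^u$ *extends* $\tau$ if it induces $\tau$ on $X$. Then: 1. $X$ admits at most one unbounded Hausdorff Lebesgue topology. It admits an unbounded Hausdorff Lebesgue topology if and only if it admits a Hausdorff Lebesgue topology. 2. Let $\tau$ be a Hausdorff Lebesgue topology on $X$. Then $\tau$ is unbounded if and only if $\tau$ extends to a locally solid topology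 on $X^u$. In this case, the extension of $\tau$ to $X^u$ can be chosen to be Hausdorff, Lebesgue and unbounded. -/

import Mathlib

open Set Filter Topology

universe u v

namespace VectorLattice

/-- A (not necessarily Hausdorff) topology `t` on a vector lattice is locally solid if it is linear
and has a base at zero consisting of solid sets. -/
structure IsLocallySolid {X : Type u} [AddCommGroup X] [Lattice X] [Module ℝ X]
    (t : TopologicalSpace X) : Prop where
  topologicalAddGroup : @IsTopologicalAddGroup X t _
  continuousSMul : @ContinuousSMul ℝ X _ _ t
  exists_solid : ∀ U ∈ @nhds X t 0,
    ∃ V ∈ @nhds X t 0, LatticeOrderedAddCommGroup.IsSolid V ∧ V ⊆ U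

/-- Order convergence of a net `(x a)` to `x₀`: there is a net `(y b)`, possibly over a different
index set, with `y b ↓ 0`, such that for each `b` one has `|x a - x₀| ≤ y b` for all `a` beyond
some index. -/
def OrderConverges {X : Type u} [AddCommGroup X] [Lattice X] {A : Type u} [Preorder A]
    (x : A → X) (x₀ : X) : Prop :=
  ∃ (B : Type u) (_ : Preorder B) (_ : IsDirectedOrder B) (_ : Nonempty B) (y : B → X),
    Antitone y ∧ IsGLB (range y) 0 ∧ ∀ b, ∃ a₀, ∀ a, a₀ ≤ a → |x a - x₀| ≤ y b

/-- A locally solid topology is Lebesgue (order continuous) if every net that is order convergent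
to zero converges to zero in the topology. -/
structure IsLebesgue {X : Type u} [AddCommGroup X] [Lattice X] [Module ℝ X]
    (t : TopologicalSpace X) : Prop where
  isLocallySolid : IsLocallySolid t
  tendsto_zero : ∀ (A : Type u) [Preorder A] [IsDirectedOrder A] [Nonempty A] (x : A → X),
    OrderConverges x 0 → Tendsto x atTop (@nhds X t 0)

/-- The filter at `x` of the unbounded topology: it is generated by the sets
`{y | |y - x| ⊓ w ∈ U}` for `0 ≤ w` and `U` a `t`-neighbourhood of zero. -/
def unboundedNhds {X : Type u} [AddCommGroup X] [Lattice X]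
    (t : TopologicalSpace X) (x : X) : Filter X :=
  ⨅ (w : X) (_ : 0 ≤ w), comap (fun y => |y - x| ⊓ w) (@nhds X t 0)

/-- The topology `u t` of unbounded `t`-convergence: a net `(x a)` converges to `x` iff
`|x a - x| ⊓ w` converges to zero in `t` for every `w ≥ 0`. -/
@[reducible]
def unboundedTopology {X : Type u} [AddCommGroup X] [Lattice X]
    (t : TopologicalSpace X) : TopologicalSpace X :=
  TopologicalSpace.mkOfNhds (unboundedNhds t)

/-- A locally solid topology `t` is unbounded if `t = u t`. -/
structure IsUnbounded {X : Type u} [AddCommGroup X] [Lattice X] [Module ℝ X]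
    (t : TopologicalSpace X) : Prop where
  isLocallySolid : IsLocallySolid t
  eq_unboundedTopology : t = unboundedTopology t

/-- `t` is a Hausdorff Lebesgue (locally solid) topology. -/
structure IsHausdorffLebesgue {X : Type u} [AddCommGroup X] [Lattice X] [Module ℝ X]
    (t : TopologicalSpace X) : Prop where
  t2Space : @T2Space X t
  isLebesgue : IsLebesgue t

/-- Universally complete vector lattices: order complete and laterally complete. (The non-emptiness
in the second clause cannot be omitted: a least upper bound of the empty set is a least element.) -/
structure IsUniversallyComplete (Y : Type v) [AddCommGroup Y] [Lattice Y] : Prop where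
  orderComplete : ∀ S : Set Y, S.Nonempty → BddAbove S → ∃ a, IsLUB S a
  laterallyComplete : ∀ S : Set Y, S.Nonempty → (∀ a ∈ S, 0 ≤ a) →
    S.Pairwise (fun a b => a ⊓ b = 0) → ∃ a, IsLUB S a

/-- `j : X → Y` exhibits `Y` as a universal completion of `X`: `Y` is universally complete and `j`
is an isomorphism of `X` onto an order dense vector sublattice of `Y`. -/
structure IsUniversalCompletion {X : Type u} {Y : Type v} [AddCommGroup X] [Lattice X] [Module ℝ X]
    [AddCommGroup Y] [Lattice Y] [Module ℝ Y] (j : X →ₗ[ℝ] Y) : Prop where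
  isUniversallyComplete : IsUniversallyComplete Y
  injective : Function.Injective j
  map_sup : ∀ a b, j (a ⊔ b) = j a ⊔ j b
  map_inf : ∀ a b, j (a ⊓ b) = j a ⊓ j b
  orderDense : ∀ y, 0 < y → ∃ x, 0 < j x ∧ j x ≤ y

/-- The topology `s` on `Y` extends the topology `t` on `X`, where `X` is regarded as a subspace of
`Y` through `j`: the subspace topology that `s` induces on `X` is `t`. -/
def Extends {X : Type u} {Y : Type v} [AddCommGroup X] [Module ℝ X] [AddCommGroup Y] [Module ℝ Y]
    (j : X →ₗ[ℝ] Y) (s : TopologicalSpace Y) (t : TopologicalSpace X) : Prop :=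
  t = TopologicalSpace.induced j s

end VectorLattice

/-! A locally solid topology is handled through its filter at zero. The topology `uτ` depends only
on the traces of `τ` on the order intervals `[0, w]`, and by Amemiya's theorem
(`IsLebesgueFilter.exists_Icc_subset`) all Hausdorff Lebesgue topologies agree there. So `uτ` is the
same for all of them, which gives uniqueness.

For an order dense `X ⊆ Y` with `Y` Archimedean, call `y` small when `|y| ∧ w` lies below a small
element of `X`. This filter (`extensionFilter`) is Hausdorff Lebesgue and unbounded on `Y`, and its
trace on `X` is `uτ`. The case `Y = X` gives existence; `Y = X^u` gives the extension.

Conversely, if `τ ≠ uτ`, a gliding hump yields a disjoint positive sequence `b n` in `X` avoiding a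
`τ`-neighbourhood of zero (`IsLebesgueFilter.exists_disjoint_seq`). In `X^u` the supremum `z` of the
`(n + 1) • b n` exists, so `b n ≤ z / (n + 1)` enters every solid neighbourhood of zero. Hence no
locally solid topology on `X^u` can extend `τ`. -/

namespace VectorLattice

/-! ### Inequalities in lattice ordered groups and consequences of the Archimedean property. -/

section Lattice

variable {X : Type*} [AddCommGroup X] [Lattice X] [IsOrderedAddMonoid X]

theorem add_inf_le_inf_add_inf {p q c : X} (hp : 0 ≤ p) (hq : 0 ≤ q) (hc : 0 ≤ c) :
    (p + q) ⊓ c ≤ p ⊓ c + q ⊓ c := by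
  rw [add_inf, inf_add, inf_add]
  refine le_inf (le_inf inf_le_left ?_) (le_inf ?_ ?_)
  · exact inf_le_right.trans (le_add_of_nonneg_right hq)
  · exact inf_le_right.trans (le_add_of_nonneg_left hp)
  · exact inf_le_right.trans (le_add_of_nonneg_left hc)

theorem inf_sum_le_sum_inf {ι : Type*} {f : ι → X} (hf : ∀ i, 0 ≤ f i) {c : X} (hc : 0 ≤ c)
    (s : Finset ι) : c ⊓ ∑ i ∈ s, f i ≤ ∑ i ∈ s, c ⊓ f i := by
  classical
  induction s using Finset.induction_on with
  | empty => simp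
  | insert a s ha ih =>
    rw [Finset.sum_insert ha, Finset.sum_insert ha]
    calc c ⊓ (f a + ∑ i ∈ s, f i) = (f a + ∑ i ∈ s, f i) ⊓ c := inf_comm _ _
      _ ≤ f a ⊓ c + (∑ i ∈ s, f i) ⊓ c :=
        add_inf_le_inf_add_inf (hf a) (Finset.sum_nonneg fun i _ => hf i) hc
      _ ≤ c ⊓ f a + ∑ i ∈ s, c ⊓ f i := by
        rw [inf_comm, inf_comm _ c]
        gcongr

theorem inf_nsmul_le {a b : X} (ha : 0 ≤ a) (hb : 0 ≤ b) (n : ℕ) :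
    a ⊓ n • b ≤ n • (a ⊓ b) := by
  simpa using inf_sum_le_sum_inf (fun _ : ℕ => hb) ha (Finset.range n)

/-- Split `a = a ∧ b + (a - b)⁺`; the second summand is disjoint from every multiple of `(b - a)⁺`.
-/
theorem inf_nsmul_posPart_le {a b : X} (ha : 0 ≤ a) (hb : 0 ≤ b) (n : ℕ) :
    a ⊓ n • ((b - a) ⊔ 0) ≤ b ⊓ a := by
  have hd : ((a - b) ⊔ 0) ⊓ ((b - a) ⊔ 0) = 0 := by
    have := posPart_inf_negPart_eq_zero (a - b)
    rwa [posPart_def, negPart_def, neg_sub] at this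
  have hd' : ((a - b) ⊔ 0) ⊓ n • ((b - a) ⊔ 0) ≤ 0 := by
    have := inf_nsmul_le (a := (a - b) ⊔ 0) (b := (b - a) ⊔ 0) le_sup_right le_sup_right n
    rwa [hd, nsmul_zero] at this
  have e : a = b ⊓ a + ((a - b) ⊔ 0) := by
    have h1 : (a - b) ⊔ 0 = (a ⊔ b) - b := by rw [sup_sub, sub_self]
    rw [h1, ← add_sub_assoc, inf_comm, inf_add_sup, add_sub_cancel_right]
  have h0 : 0 ≤ n • ((b - a) ⊔ 0) := nsmul_nonneg le_sup_right n
  calc a ⊓ n • ((b - a) ⊔ 0) = (b ⊓ a + ((a - b) ⊔ 0)) ⊓ n • ((b - a) ⊔ 0) := by rw [← e]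
    _ ≤ (b ⊓ a) ⊓ n • ((b - a) ⊔ 0) + ((a - b) ⊔ 0) ⊓ n • ((b - a) ⊔ 0) :=
      add_inf_le_inf_add_inf (le_inf hb ha) le_sup_right h0
    _ ≤ b ⊓ a + 0 := add_le_add inf_le_left hd'
    _ = b ⊓ a := add_zero _

/-- A lattice ordered group is Archimedean if only elements `z ≤ 0` have all their multiples
bounded above by a single element. -/
def IsArchimedean (X : Type*) [AddCommGroup X] [Lattice X] : Prop :=
  ∀ z d : X, (∀ n : ℕ, n • z ≤ d) → z ≤ 0

/-- A lower bound `z` of these differences can be added to any lower bound of `D`, so all `n • z`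
stay below `D`. This replaces `d - inf D` when `D` has no infimum. -/
theorem IsArchimedean.isGLB_sub_lowerBounds (hX : IsArchimedean X) {D : Set X}
    (hne : D.Nonempty) (h0 : 0 ∈ lowerBounds D) :
    IsGLB {x | ∃ d ∈ D, ∃ e ∈ lowerBounds D, x = d - e} 0 := by
  refine ⟨?_, fun z hz => ?_⟩
  · rintro _ ⟨d, hd, e, he, rfl⟩
    exact sub_nonneg.2 (he hd)
  · obtain ⟨d, hd⟩ := hne
    refine hX z d fun n => ?_
    suffices n • z ∈ lowerBounds D from this hd
    induction n with
    | zero => simpa using h0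
    | succ n ih =>
      intro b hb
      have := hz ⟨b, hb, _, ih, rfl⟩
      rw [succ_nsmul]
      rwa [le_sub_iff_add_le, add_comm] at this

theorem directedOn_sub_lowerBounds {D : Set X} (hD : DirectedOn (· ≥ ·) D) :
    DirectedOn (· ≥ ·) {x | ∃ d ∈ D, ∃ e ∈ lowerBounds D, x = d - e} := by
  rintro _ ⟨d, hd, e, he, rfl⟩ _ ⟨d', hd', e', he', rfl⟩
  obtain ⟨c, hc, h, h'⟩ := hD d hd d' hd'
  exact ⟨_, ⟨c, hc, e ⊔ e', fun b hb => sup_le (he hb) (he' hb), rfl⟩,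
    sub_le_sub h le_sup_left, sub_le_sub h' le_sup_right⟩

/-- Here `e` plays the role of an element below `sup A`, which need not exist. If `z ≥ 0` were below
all `e - e ∧ a`, then `z` could be subtracted from any upper bound of `A` again and again. -/
theorem IsArchimedean.isGLB_sub_inf (hX : IsArchimedean X) {A : Set X} (hne : A.Nonempty)
    (hbdd : BddAbove A) {e : X} (he : ∀ d ∈ upperBounds A, e ≤ d) :
    IsGLB ((fun a => e - e ⊓ a) '' A) 0 := by
  refine ⟨?_, fun z hz => ?_⟩
  · rintro _ ⟨a, -, rfl⟩
    exact sub_nonneg.2 inf_le_left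
  · have hz' : ∀ a ∈ A, z ⊔ 0 ≤ e - e ⊓ a := fun a ha =>
      sup_le (hz ⟨a, ha, rfl⟩) (sub_nonneg.2 inf_le_left)
    refine le_sup_left.trans (b := z ⊔ 0) ?_
    obtain ⟨d, hd⟩ := hbdd
    obtain ⟨a, ha⟩ := hne
    refine hX _ (d - a) fun n => ?_
    suffices d - n • (z ⊔ 0) ∈ upperBounds A by
      have := this ha
      rwa [le_sub_comm] at this
    induction n with
    | zero => simpa using hd
    | succ n ih =>
      intro b hb
      have h1 := he _ ih
      have h2 := hz' b hb
      have h3 : b = e ⊔ b - e + e ⊓ b := by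
        rw [sub_add_eq_add_sub, add_comm, inf_add_sup, add_sub_cancel_left]
      calc b = e ⊔ b - e + e ⊓ b := h3
        _ ≤ (d - n • (z ⊔ 0)) - e + (e - (z ⊔ 0)) :=
          add_le_add (sub_le_sub_right (sup_le h1 (ih hb)) _) (by rwa [le_sub_comm])
        _ = d - (n + 1) • (z ⊔ 0) := by rw [succ_nsmul]; abel

theorem IsUniversallyComplete.isArchimedean (hX : IsUniversallyComplete X) : IsArchimedean X := by
  intro z d h
  obtain ⟨a, ha⟩ := hX.orderComplete (range fun n : ℕ => n • z) (range_nonempty _)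
    ⟨d, by rintro _ ⟨n, rfl⟩; exact h n⟩
  have : a ≤ a - z := ha.2 <| by
    rintro _ ⟨n, rfl⟩
    rw [le_sub_iff_add_le]
    exact (succ_nsmul z n).symm.le.trans (ha.1 ⟨n + 1, rfl⟩)
  simpa using this

end Lattice

/-! ### Absolute values and scalar multiplication. -/

section Module

variable {X : Type*} [AddCommGroup X] [Lattice X] [Module ℝ X] [IsOrderedModule ℝ X]

theorem abs_smul_le (r : ℝ) (x : X) : |r • x| ≤ |r| • |x| := by
  have key : ∀ (r : ℝ) (x : X), r • x ≤ |r| • |x| := fun r x => by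
    rcases le_total 0 r with h | h
    · rw [abs_of_nonneg h]
      exact smul_le_smul_of_nonneg_left (le_abs_self x) h
    · rw [abs_of_nonpos h, ← neg_smul_neg r x]
      exact smul_le_smul_of_nonneg_left (neg_le_abs x) (neg_nonneg.2 h)
  refine sup_le (key r x) ?_
  rw [← neg_smul, ← abs_neg r]
  exact key (-r) x

theorem smul_abs_le [IsOrderedAddMonoid X] {r : ℝ} (hr : 0 ≤ r) (x : X) : r • |x| ≤ |r • x| := by
  rcases hr.eq_or_lt with rfl | hr
  · simp
  · have := smul_le_smul_of_nonneg_left (abs_smul_le r⁻¹ (r • x)) hr.le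
    rwa [smul_smul, inv_mul_cancel₀ hr.ne', one_smul, abs_of_pos (inv_pos.2 hr), smul_smul,
      mul_inv_cancel₀ hr.ne', one_smul] at this

end Module

/-! ### Neighbourhood filters of locally solid topologies -/

open LatticeOrderedAddCommGroup (IsSolid)

section Solid

variable {X : Type*} [AddCommGroup X] [Lattice X]

/-- The properties that characterise the neighbourhood filters of zero of locally solid
topologies. -/
structure IsSolidFilter [Module ℝ X] (F : Filter X) : Prop where
  exists_solid : ∀ U ∈ F, ∃ V ∈ F, IsSolid V ∧ V ⊆ U
  exists_add : ∀ U ∈ F, ∃ V ∈ F, ∀ x ∈ V, ∀ y ∈ V, x + y ∈ U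
  exists_smul_mem : ∀ U ∈ F, ∀ x : X, ∃ r : ℝ, 0 < r ∧ r • x ∈ U

/-- The properties that characterise the neighbourhood filters of zero of Hausdorff Lebesgue
topologies. -/
structure IsLebesgueFilter [Module ℝ X] (F : Filter X) : Prop extends IsSolidFilter F where
  exists_mem : ∀ D : Set X, D.Nonempty → DirectedOn (· ≥ ·) D → IsGLB D 0 →
    ∀ U ∈ F, ∃ d ∈ D, d ∈ U
  separated : ∀ x : X, (∀ U ∈ F, x ∈ U) → x = 0

/-- A normal sequence of solid members of a filter. -/
structure IsNormalSeq (F : Filter X) (s : ℕ → Set X) : Prop where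
  mem : ∀ n, s n ∈ F
  solid : ∀ n, IsSolid (s n)
  add : ∀ n, ∀ x ∈ s (n + 1), ∀ y ∈ s (n + 1), x + y ∈ s n

theorem IsNormalSeq.inter {F : Filter X} {s s' : ℕ → Set X} (hs : IsNormalSeq F s) (hs' : IsNormalSeq F s') :
    IsNormalSeq F fun n => s n ∩ s' n where
  mem n := inter_mem (hs.mem n) (hs'.mem n)
  solid n := fun _ hx _ hy => ⟨hs.solid n hx.1 hy, hs'.solid n hx.2 hy⟩
  add n := fun x hx y hy => ⟨hs.add n x hx.1 y hy.1, hs'.add n x hx.2 y hy.2⟩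

variable [IsOrderedAddMonoid X]

theorem _root_.LatticeOrderedAddCommGroup.IsSolid.mem_of_le {V : Set X} (hV : IsSolid V) {x y : X}
    (hy : y ∈ V) (h0 : 0 ≤ x) (h : x ≤ y) : x ∈ V :=
  hV hy (by rwa [abs_of_nonneg h0, abs_of_nonneg (h0.trans h)])

theorem _root_.LatticeOrderedAddCommGroup.IsSolid.zero_mem {V : Set X} (hV : IsSolid V) {y : X}
    (hy : y ∈ V) : 0 ∈ V :=
  hV hy (by simp)

theorem _root_.LatticeOrderedAddCommGroup.IsSolid.abs_mem_iff {V : Set X} (hV : IsSolid V) {y : X} :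
    |y| ∈ V ↔ y ∈ V :=
  ⟨fun h => hV h (by simp), fun h => hV h (by simp)⟩

variable [Module ℝ X] {F : Filter X}

theorem IsSolidFilter.zero_mem (hF : IsSolidFilter F) {U : Set X} (hU : U ∈ F) : 0 ∈ U := by
  obtain ⟨V, hV, hs, hVU⟩ := hF.exists_solid U hU
  obtain ⟨r, -, hr⟩ := hF.exists_smul_mem V hV 0
  exact hVU (hs.zero_mem hr)

theorem IsSolidFilter.exists_solid_add (hF : IsSolidFilter F) {U : Set X} (hU : U ∈ F) :
    ∃ V ∈ F, IsSolid V ∧ V ⊆ U ∧ ∀ x ∈ V, ∀ y ∈ V, x + y ∈ U := by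
  obtain ⟨V, hV, hVU⟩ := hF.exists_add U hU
  obtain ⟨W, hW, hs, hWV⟩ := hF.exists_solid V hV
  refine ⟨W, hW, hs, fun x hx => ?_, fun x hx y hy => hVU x (hWV hx) y (hWV hy)⟩
  simpa using hVU x (hWV hx) 0 (hF.zero_mem hV)

theorem IsSolidFilter.exists_normalSeq (hF : IsSolidFilter F) {U : Set X} (hU : U ∈ F) :
    ∃ s, IsNormalSeq F s ∧ s 0 ⊆ U := by
  choose g hg hs hsub hadd using fun U : {U // U ∈ F} => hF.exists_solid_add U.2
  let s : ℕ → {U // U ∈ F} := Nat.rec ⟨g ⟨U, hU⟩, hg _⟩ fun _ V => ⟨g V, hg V⟩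
  refine ⟨fun n => (s n).1, ⟨fun n => (s n).2, fun n => ?_, fun n => hadd (s n)⟩, hsub _⟩
  cases n <;> exact hs _

theorem IsNormalSeq.zero_mem {s : ℕ → Set X} (hs : IsNormalSeq F s) (hF : IsSolidFilter F) (n : ℕ) :
    0 ∈ s n :=
  hF.zero_mem (hs.mem n)

theorem IsNormalSeq.sum_mem {s : ℕ → Set X} (hs : IsNormalSeq F s) (hF : IsSolidFilter F)
    {x : ℕ → X} (m : ℕ) (hx : ∀ i, x i ∈ s (m + 1 + i)) (p : ℕ) :
    ∑ i ∈ Finset.range p, x i ∈ s m := by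
  induction p generalizing m x with
  | zero => simpa using hs.zero_mem hF m
  | succ p ih =>
    rw [Finset.sum_range_succ']
    refine hs.add m _ (ih (m + 1) fun i => ?_) _ (by simpa using hx 0)
    rw [add_right_comm (m + 1)]
    exact hx (i + 1)

theorem IsLebesgueFilter.exists_sub_lowerBounds_mem (hF : IsLebesgueFilter F)
    (hX : IsArchimedean X) {D : Set X} (hne : D.Nonempty) (hD : DirectedOn (· ≥ ·) D)
    (h0 : 0 ∈ lowerBounds D) {U : Set X} (hU : U ∈ F) :
    ∃ d ∈ D, ∃ e ∈ lowerBounds D, 0 ≤ e ∧ d - e ∈ U := by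
  obtain ⟨V, hV, hs, hVU⟩ := hF.exists_solid U hU
  obtain ⟨d₀, hd₀⟩ := hne
  obtain ⟨_, ⟨d, hd, e, he, rfl⟩, hm⟩ := hF.exists_mem
    {x | ∃ d ∈ D, ∃ e ∈ lowerBounds D, x = d - e} ⟨_, d₀, hd₀, 0, h0, rfl⟩
    (directedOn_sub_lowerBounds hD) (hX.isGLB_sub_lowerBounds ⟨d₀, hd₀⟩ h0) V hV
  refine ⟨d, hd, e ⊔ 0, fun b hb => sup_le (he hb) (h0 hb), le_sup_right, hVU ?_⟩
  exact hs.mem_of_le hm (sub_nonneg.2 (sup_le (he hd) (h0 hd))) (sub_le_sub_left le_sup_left _)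

theorem IsLebesgueFilter.exists_sub_inf_mem (hF : IsLebesgueFilter F)
    (hX : IsArchimedean X) {A : Set X} (hne : A.Nonempty) (hA : SupClosed A) (hbdd : BddAbove A)
    {e : X} (he : ∀ d ∈ upperBounds A, e ≤ d) {U : Set X} (hU : U ∈ F) :
    ∃ a ∈ A, e - e ⊓ a ∈ U := by
  obtain ⟨_, ⟨a, ha, rfl⟩, h⟩ := hF.exists_mem _ (hne.image _) (by
    rintro _ ⟨a, ha, rfl⟩ _ ⟨b, hb, rfl⟩
    refine ⟨_, ⟨a ⊔ b, hA ha hb, rfl⟩, ?_, ?_⟩ <;> dsimp only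
    · exact sub_le_sub_left (inf_le_inf_left _ le_sup_left) _
    · exact sub_le_sub_left (inf_le_inf_left _ le_sup_right) _)
    (hX.isGLB_sub_inf hne hbdd he) U hU
  exact ⟨a, ha, h⟩

end Solid

/-! ### Lebesgue topologies agree on order intervals -/

section Interval

open LatticeOrderedAddCommGroup (IsSolid)

variable {X : Type*} [AddCommGroup X] [Lattice X] [IsOrderedAddMonoid X] [Module ℝ X]
  {F G : Filter X}

/-- Let `D` collect the upper bounds of `[0, w] ∩ ⋂ s n` over all normal sequences `s` of `F`. Each
such intersection is closed under suprema, so order continuity of `F` puts `e⁺`, for any lower bound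
`e` of `D`, in every member of `F`. Thus `inf D = 0`, and order continuity of `G` applies to `D`. -/
theorem IsLebesgueFilter.exists_normalSeq_subset (hF : IsLebesgueFilter F)
    (hG : IsLebesgueFilter G) (hX : IsArchimedean X) {w : X} (hw : 0 ≤ w) {V : Set X} (hV : V ∈ G) :
    ∃ s, IsNormalSeq F s ∧ ∀ x, 0 ≤ x → x ≤ w → (∀ n, x ∈ s n) → x ∈ V := by
  obtain ⟨V', hV', hsol, hsub⟩ := hG.exists_solid V hV
  obtain ⟨s₀, hs₀, -⟩ := hF.exists_normalSeq univ_mem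
  let D : Set X := {d | ∃ s, IsNormalSeq F s ∧ ∀ x, 0 ≤ x → x ≤ w → (∀ n, x ∈ s n) → x ≤ d}
  suffices hD : IsGLB D 0 by
    obtain ⟨d, ⟨s, hs, hd⟩, hdV⟩ := hG.exists_mem D ⟨w, s₀, hs₀, fun x _ h _ => h⟩ (by
      rintro d ⟨s, hs, h⟩ d' ⟨s', hs', h'⟩
      exact ⟨d ⊓ d', ⟨_, hs.inter hs', fun x h0 hw hx => le_inf (h x h0 hw fun n => (hx n).1)
        (h' x h0 hw fun n => (hx n).2)⟩, inf_le_left, inf_le_right⟩) hD V' hV'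
    exact ⟨s, hs, fun x h0 hxw hx => hsub (hsol.mem_of_le hdV h0 (hd x h0 hxw hx))⟩
  refine ⟨?_, fun e he => ?_⟩
  · rintro d ⟨s, hs, h⟩
    exact h 0 le_rfl hw fun n => hs.zero_mem hF.toIsSolidFilter n
  · suffices e ⊔ 0 = 0 from le_sup_left.trans this.le
    refine hF.separated _ fun U hU => ?_
    obtain ⟨s, hs, hsU⟩ := hF.exists_normalSeq hU
    let A : Set X := {x | 0 ≤ x ∧ x ≤ w ∧ ∀ n, x ∈ s n}
    have hA : SupClosed A := fun x hx y hy => ⟨hx.1.trans le_sup_left, sup_le hx.2.1 hy.2.1,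
      fun n => (hs.solid n).mem_of_le (hs.add n x (hx.2.2 _) y (hy.2.2 _))
        (hx.1.trans le_sup_left) (sup_le (le_add_of_nonneg_right hy.1)
          (le_add_of_nonneg_left hx.1))⟩
    have h0A : (0 : X) ∈ A := ⟨le_rfl, hw, hs.zero_mem hF.toIsSolidFilter⟩
    obtain ⟨a, ha, hm⟩ := hF.exists_sub_inf_mem hX ⟨0, h0A⟩ hA ⟨w, fun x hx => hx.2.1⟩
      (e := e ⊔ 0) (fun d hd => sup_le (he ⟨s, hs, fun x h0 hxw hx => hd ⟨h0, hxw, hx⟩⟩) (hd h0A))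
      (hs.mem 1)
    have := hs.add 0 _ hm ((e ⊔ 0) ⊓ a)
      ((hs.solid 1).mem_of_le (ha.2.2 1) (le_inf le_sup_right ha.1) inf_le_right)
    rw [sub_add_cancel] at this
    exact hsU this

/-- Amemiya's theorem: on an order interval, a Hausdorff Lebesgue topology is finer than any other
one. -/
theorem IsLebesgueFilter.exists_Icc_subset (hF : IsLebesgueFilter F)
    (hG : IsLebesgueFilter G) (hX : IsArchimedean X) {w : X} (hw : 0 ≤ w) {V : Set X} (hV : V ∈ G) :
    ∃ U ∈ F, ∀ x, 0 ≤ x → x ≤ w → x ∈ U → x ∈ V := by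
  obtain ⟨V₁, hV₁, hsol, hsub⟩ := hG.exists_solid V hV
  obtain ⟨V₂, hV₂, hadd⟩ := hG.exists_add V₁ hV₁
  obtain ⟨s, hs, hN⟩ := hF.exists_normalSeq_subset hG hX hw hV₂
  by_contra! hcon
  choose x hx0 hxw hxs hxV using fun n => hcon (s n) (hs.mem n)
  -- The eventual upper bounds stand in for `limsup x`, and `e` below for its value. Both `d - e`
  -- and `e` turn out to be `G`-small, hence so is `x n ≤ d`.
  let D : Set X := {d | ∃ n, ∀ k, n ≤ k → x k ≤ d}
  obtain ⟨d, ⟨n, hd⟩, e, he, he0, hde⟩ := hG.exists_sub_lowerBounds_mem hX (D := D)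
    ⟨w, 0, fun k _ => hxw k⟩ (by
      rintro d ⟨n, h⟩ d' ⟨n', h'⟩
      exact ⟨d ⊓ d', ⟨max n n', fun k hk => le_inf (h k (le_of_max_le_left hk))
        (h' k (le_of_max_le_right hk))⟩, inf_le_left, inf_le_right⟩)
    (by rintro d ⟨n, h⟩; exact (hx0 n).trans (h n le_rfl)) hV₂
  -- Borel–Cantelli: up to an `F`-small error `e` lies below a finite sum of terms from index `n +
  -- 2` on, and such sums lie in `s (n + 1)`.
  have hes : ∀ n, e ∈ s n := fun n => by
    let A : Set X := {a | 0 ≤ a ∧ a ≤ w ∧ ∃ p, a ≤ ∑ i ∈ Finset.range p, x (n + 1 + 1 + i)}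
    have hmono : Monotone fun p => ∑ i ∈ Finset.range p, x (n + 1 + 1 + i) := fun p q h =>
      Finset.sum_le_sum_of_subset_of_nonneg (Finset.range_mono h) fun i _ _ => hx0 _
    have hA : SupClosed A := by
      rintro a ⟨ha, haw, p, hp⟩ b ⟨hb, hbw, q, hq⟩
      exact ⟨ha.trans le_sup_left, sup_le haw hbw, max p q,
        sup_le (hp.trans (hmono (le_max_left _ _))) (hq.trans (hmono (le_max_right _ _)))⟩
    obtain ⟨a, ⟨ha, -, p, hp⟩, hm⟩ := hF.exists_sub_inf_mem hX (A := A)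
      ⟨0, le_rfl, hw, 0, by simp⟩ hA ⟨w, fun x hx => hx.2.1⟩
      (e := e) (fun d hd => he ⟨n + 1 + 1, fun k hk => hd ⟨hx0 k, hxw k, k - (n + 1 + 1) + 1, by
        refine (le_of_eq ?_).trans (Finset.single_le_sum (f := fun i => x (n + 1 + 1 + i))
          (fun i _ => hx0 _) (Finset.self_mem_range_succ _))
        rw [Nat.add_sub_cancel' hk]⟩⟩) (hs.mem (n + 1))
    have := hs.add n _ hm _ ((hs.solid _).mem_of_le
      (hs.sum_mem hF.toIsSolidFilter (n + 1) (fun i => hxs (n + 1 + 1 + i)) p)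
      (le_inf he0 ha) (inf_le_right.trans hp))
    rwa [sub_add_cancel] at this
  refine hxV n (hsub (hsol.mem_of_le (hadd _ hde _ (hN e he0 ?_ hes)) (hx0 n) ?_))
  · exact he ⟨0, fun k _ => hxw k⟩
  · rw [sub_add_cancel]
    exact hd n le_rfl

end Interval

end VectorLattice

namespace VectorLattice

open LatticeOrderedAddCommGroup (IsSolid)

/-! ### Topologies from filters and back -/

section Topology

variable {X : Type u} [AddCommGroup X] [Lattice X] [Module ℝ X]

/-- The translation invariant topology whose neighbourhood filter at zero is `F`. -/
abbrev topologyOfFilter {X : Type u} [AddCommGroup X] (F : Filter X) : TopologicalSpace X :=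
  TopologicalSpace.mkOfNhds fun x => comap (fun y => y - x) F

theorem IsSolidFilter.nhds_topologyOfFilter [IsOrderedAddMonoid X] {F : Filter X}
    (hF : IsSolidFilter F) (x : X) :
    @nhds X (topologyOfFilter F) x = comap (fun y => y - x) F := by
  refine TopologicalSpace.nhds_mkOfNhds (fun x => comap (fun y => y - x) F) x (fun y => ?_) ?_
  · refine pure_le_iff.2 ?_
    rintro s ⟨t, ht, hts⟩
    exact hts (by simpa using hF.zero_mem ht)
  · rintro a s ⟨t, ht, hts⟩
    obtain ⟨V, hV, hVt⟩ := hF.exists_add t ht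
    refine ⟨V, hV, fun y hy => ⟨V, hV, fun z hz => hts ?_⟩⟩
    simpa using hVt _ hz _ hy

theorem IsSolidFilter.nhds_zero_topologyOfFilter [IsOrderedAddMonoid X] {F : Filter X}
    (hF : IsSolidFilter F) : @nhds X (topologyOfFilter F) 0 = F := by
  simpa [hF.nhds_topologyOfFilter] using! comap_id

theorem IsSolidFilter.exists_nsmul_mem [IsOrderedAddMonoid X] {F : Filter X}
    (hF : IsSolidFilter F) {U : Set X} (hU : U ∈ F) (n : ℕ) : ∃ V ∈ F, ∀ x ∈ V, n • x ∈ U := by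
  induction n generalizing U with
  | zero => exact ⟨U, hU, fun x _ => by simpa using hF.zero_mem hU⟩
  | succ n ih =>
    obtain ⟨V, hV, hVU⟩ := hF.exists_add U hU
    obtain ⟨W, hW, hWV⟩ := ih hV
    exact ⟨W ∩ V, inter_mem hW hV, fun x hx => by
      rw [succ_nsmul]; exact hVU _ (hWV x hx.1) _ hx.2⟩

theorem IsLocallySolid.isSolidFilter {t : TopologicalSpace X} (ht : IsLocallySolid t) :
    IsSolidFilter (@nhds X t 0) where
  exists_solid := ht.exists_solid
  exists_add U hU := by
    have := ht.topologicalAddGroup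
    obtain ⟨V, hV, h⟩ := exists_nhds_zero_half hU
    exact ⟨V, hV, h⟩
  exists_smul_mem U hU x := by
    have := ht.continuousSMul
    have h : Tendsto (fun r : ℝ => r • x) (𝓝[>] 0) (𝓝 0) := by
      have : Continuous fun r : ℝ => r • x := by fun_prop
      simpa using (this.tendsto 0).mono_left nhdsWithin_le_nhds
    obtain ⟨r, hr, h0⟩ := ((h.eventually hU).and self_mem_nhdsWithin).exists
    exact ⟨r, h0, hr⟩

variable [IsOrderedAddMonoid X]

theorem IsHausdorffLebesgue.isLebesgueFilter {t : TopologicalSpace X}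
    (ht : IsHausdorffLebesgue t) : IsLebesgueFilter (@nhds X t 0) where
  toIsSolidFilter := ht.isLebesgue.isLocallySolid.isSolidFilter
  exists_mem D hne hD h0 U hU := by
    -- The set `D` with reversed order indexes itself as a decreasing net, in the universe of `X`.
    have : Nonempty Dᵒᵈ := ⟨OrderDual.toDual ⟨_, hne.some_mem⟩⟩
    have : IsDirectedOrder Dᵒᵈ := ⟨fun a b => by
      obtain ⟨c, hc, h, h'⟩ := hD _ (OrderDual.ofDual a).2 _ (OrderDual.ofDual b).2
      exact ⟨OrderDual.toDual ⟨c, hc⟩, h, h'⟩⟩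
    let x : Dᵒᵈ → X := fun d => (OrderDual.ofDual d).1
    have hr : range x = D := by
      ext y
      exact ⟨by rintro ⟨d, rfl⟩; exact (OrderDual.ofDual d).2,
        fun hy => ⟨OrderDual.toDual ⟨y, hy⟩, rfl⟩⟩
    have hx := ht.isLebesgue.tendsto_zero Dᵒᵈ x
      ⟨Dᵒᵈ, _, ‹_›, ‹_›, x, fun _ _ h => h, by rwa [hr], fun b => ⟨b, fun a hab => by
        rw [sub_zero, abs_of_nonneg (h0.1 (OrderDual.ofDual a).2)]; exact hab⟩⟩
    obtain ⟨a, ha⟩ := (hx.eventually hU).exists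
    exact ⟨_, (OrderDual.ofDual a).2, ha⟩
  separated x hx := by
    have := ht.t2Space
    by_contra hne
    exact hx {x}ᶜ (isOpen_compl_singleton.mem_nhds fun h => hne h.symm) rfl

variable [IsOrderedModule ℝ X]

theorem abs_smul_le_abs_smul {r s : ℝ} (h : |r| ≤ s) (x : X) : |r • x| ≤ |s • x| :=
  (abs_smul_le r x).trans <| (smul_le_smul_of_nonneg_right h (abs_nonneg x)).trans
    (smul_abs_le ((abs_nonneg r).trans h) x)

theorem IsSolidFilter.isLocallySolid {F : Filter X} (hF : IsSolidFilter F) :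
    IsLocallySolid (topologyOfFilter F) := by
  let := topologyOfFilter F
  have h0 : 𝓝 (0 : X) = F := hF.nhds_zero_topologyOfFilter
  have hg : IsTopologicalAddGroup X := by
    refine IsTopologicalAddGroup.of_comm_of_nhds_zero ?_ ?_ fun x => ?_
    · rw [h0]
      intro U hU
      obtain ⟨V, hV, hVU⟩ := hF.exists_add U hU
      exact mem_map.2 <| mem_of_superset (prod_mem_prod hV hV) fun p hp => hVU _ hp.1 _ hp.2
    · rw [h0]
      intro U hU
      obtain ⟨V, hV, hs, hVU⟩ := hF.exists_solid U hU
      exact mem_map.2 <| mem_of_superset hV fun p hp => hVU (hs hp (by simp))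
    · rw [h0, hF.nhds_topologyOfFilter x]
      exact (map_eq_comap_of_inverse (by ext; simp) (by ext; simp)).symm
  refine ⟨hg, ContinuousSMul.of_nhds_zero ?_ (fun m => ?_) fun a => ?_, ?_⟩
  · rw [h0]
    intro U hU
    obtain ⟨V, hV, hs, hVU⟩ := hF.exists_solid U hU
    refine mem_map.2 <| mem_of_superset (prod_mem_prod (Metric.ball_mem_nhds (0 : ℝ) one_pos) hV)
      fun p hp => hVU (hs hp.2 ?_)
    simpa using abs_smul_le_abs_smul (r := p.1) (s := 1)
      (by simpa using (Metric.mem_ball.1 hp.1).le) p.2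
  · rw [h0]
    intro U hU
    obtain ⟨V, hV, hs, hVU⟩ := hF.exists_solid U hU
    obtain ⟨r, hr, hm⟩ := hF.exists_smul_mem V hV m
    refine mem_map.2 <| mem_of_superset (Metric.ball_mem_nhds (0 : ℝ) hr) fun a ha => hVU (hs hm ?_)
    exact abs_smul_le_abs_smul (by simpa using (Metric.mem_ball.1 ha).le) m
  · rw [h0]
    intro U hU
    obtain ⟨V, hV, hs, hVU⟩ := hF.exists_solid U hU
    obtain ⟨n, hn⟩ := exists_nat_ge |a|
    obtain ⟨W, hW, hWV⟩ := hF.exists_nsmul_mem hV n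
    refine mem_map.2 <| mem_of_superset hW fun x hx => hVU (hs (hWV x hx) ?_)
    rw [← Nat.cast_smul_eq_nsmul ℝ]
    exact abs_smul_le_abs_smul hn x
  · rw [h0]
    exact hF.exists_solid

theorem IsLocallySolid.eq_topologyOfFilter {t : TopologicalSpace X} (ht : IsLocallySolid t) :
    t = topologyOfFilter (@nhds X t 0) :=
  IsTopologicalAddGroup.ext ht.topologicalAddGroup
    ht.isSolidFilter.isLocallySolid.topologicalAddGroup
    ht.isSolidFilter.nhds_zero_topologyOfFilter.symm

theorem IsLebesgueFilter.isHausdorffLebesgue {F : Filter X} (hF : IsLebesgueFilter F) :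
    IsHausdorffLebesgue (topologyOfFilter F) := by
  have hs := hF.toIsSolidFilter.isLocallySolid
  have h0 := hF.toIsSolidFilter.nhds_zero_topologyOfFilter
  let := topologyOfFilter F
  have := hs.topologicalAddGroup
  refine ⟨IsTopologicalAddGroup.t2Space_of_zero_sep fun x hx => ?_, hs, ?_⟩
  · by_contra! h
    rw [h0] at h
    exact hx (hF.separated x h)
  · rintro A _ _ _ x ⟨B, _, _, _, y, hy, hglb, hxy⟩ U hU
    rw [h0] at hU
    obtain ⟨V, hV, hsol, hVU⟩ := hF.exists_solid U hU
    obtain ⟨_, ⟨b, rfl⟩, hb⟩ := hF.exists_mem (range y) (range_nonempty y) (by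
      rintro _ ⟨b, rfl⟩ _ ⟨b', rfl⟩
      obtain ⟨c, h, h'⟩ := exists_ge_ge b b'
      exact ⟨y c, ⟨c, rfl⟩, hy h, hy h'⟩) hglb V hV
    obtain ⟨a₀, ha₀⟩ := hxy b
    refine mem_map.2 <| mem_of_superset (mem_atTop a₀) fun a ha => hVU (hsol.abs_mem_iff.1 ?_)
    exact hsol.mem_of_le hb (abs_nonneg _) (by simpa using ha₀ a ha)

/-- If all `n • z ≤ d`, then `z⁺ ≤ |d| / n` lies in every solid neighbourhood of zero, and
separation gives `z⁺ = 0`. -/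
theorem IsLebesgueFilter.isArchimedean {F : Filter X} (hF : IsLebesgueFilter F) :
    IsArchimedean X := by
  intro z d h
  suffices z ⊔ 0 = 0 from le_sup_left.trans this.le
  refine hF.separated _ fun U hU => ?_
  obtain ⟨V, hV, hsol, hVU⟩ := hF.exists_solid U hU
  obtain ⟨r, hr, hm⟩ := hF.exists_smul_mem V hV |d|
  obtain ⟨n, hn⟩ := exists_nat_gt r⁻¹
  have hn0 : (0 : ℝ) < n := (inv_pos.2 hr).trans hn
  refine hVU (hsol.mem_of_le hm le_sup_right
    (sup_le ?_ (smul_nonneg hr.le (abs_nonneg d))))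
  have h1 : (n : ℝ) • z ≤ |d| := by
    rw [Nat.cast_smul_eq_nsmul]
    exact (h n).trans (le_abs_self d)
  have h2 := smul_le_smul_of_nonneg_left h1 (inv_pos.2 hn0).le
  rw [smul_smul, inv_mul_cancel₀ hn0.ne', one_smul] at h2
  exact h2.trans (smul_le_smul_of_nonneg_right (inv_lt_of_inv_lt₀ hr hn).le (abs_nonneg d))

end Topology

/-! ### The unbounded modification of a filter -/

section Unbounded

variable {X : Type u} [AddCommGroup X] [Lattice X]

/-- The neighbourhood filter of zero of the unbounded modification. -/
def unboundedFilter (F : Filter X) : Filter X :=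
  ⨅ (w : X) (_ : 0 ≤ w), comap (fun y => |y| ⊓ w) F

theorem unboundedTopology_eq (t : TopologicalSpace X) :
    unboundedTopology t = topologyOfFilter (unboundedFilter (@nhds X t 0)) := by
  unfold unboundedTopology topologyOfFilter
  congr 1
  ext1 x
  simp [unboundedNhds, unboundedFilter, comap_iInf, comap_comap, Function.comp_def]

variable [IsOrderedAddMonoid X] [Module ℝ X]

theorem IsSolidFilter.mem_unboundedFilter {F : Filter X} (hF : IsSolidFilter F) {A : Set X} :
    A ∈ unboundedFilter F ↔ ∃ U ∈ F, ∃ w, 0 ≤ w ∧ {y | |y| ⊓ w ∈ U} ⊆ A := by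
  unfold unboundedFilter
  refine (mem_biInf_of_directed (s := {w : X | 0 ≤ w}) ?_ ⟨0, le_rfl⟩).trans ?_
  rotate_left
  · constructor
    · rintro ⟨w, hw, U, hU, h⟩
      exact ⟨U, hU, w, hw, h⟩
    · rintro ⟨U, hU, w, hw, h⟩
      exact ⟨w, hw, U, hU, h⟩
  · have key : ∀ w w' : X, 0 ≤ w → w ≤ w' →
        comap (fun y => |y| ⊓ w') F ≤ comap (fun y => |y| ⊓ w) F := by
      rintro w w' hw h A ⟨U, hU, hA⟩
      obtain ⟨V, hV, hs, hVU⟩ := hF.exists_solid U hU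
      exact ⟨V, hV, fun y hy => hA (hVU (hs.mem_of_le hy (le_inf (abs_nonneg y) hw)
        (inf_le_inf_left _ h)))⟩
    exact fun w hw w' hw' => ⟨w ⊔ w', le_sup_of_le_left hw,
      key _ _ hw le_sup_left, key _ _ hw' le_sup_right⟩

/-- The hypothesis `h` ensures that `mkOfNhds` really has the prescribed neighbourhood filters. -/
theorem IsUnbounded.unboundedFilter_eq {t : TopologicalSpace X} (ht : IsUnbounded t)
    (h : IsSolidFilter (unboundedFilter (@nhds X t 0))) :
    unboundedFilter (@nhds X t 0) = @nhds X t 0 := by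
  have := ht.eq_unboundedTopology
  rw [unboundedTopology_eq] at this
  conv_rhs => rw [this]
  exact h.nhds_zero_topologyOfFilter.symm

theorem IsSolidFilter.unboundedFilter_ge {F : Filter X} (hF : IsSolidFilter F) :
    F ≤ unboundedFilter F := by
  intro A hA
  obtain ⟨U, hU, w, hw, h⟩ := hF.mem_unboundedFilter.1 hA
  obtain ⟨V, hV, hs, hVU⟩ := hF.exists_solid U hU
  exact mem_of_superset hV fun y hy => h (hVU (hs.mem_of_le (hs.abs_mem_iff.2 hy)
    (le_inf (abs_nonneg y) hw) inf_le_left))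

variable [IsOrderedModule ℝ X]

theorem IsSolidFilter.isUnbounded {F : Filter X} (hF : IsSolidFilter F)
    (h : unboundedFilter F = F) : IsUnbounded (topologyOfFilter F) where
  isLocallySolid := hF.isLocallySolid
  eq_unboundedTopology := by rw [unboundedTopology_eq, hF.nhds_zero_topologyOfFilter, h]

theorem IsLocallySolid.isUnbounded {t : TopologicalSpace X} (ht : IsLocallySolid t)
    (h : unboundedFilter (@nhds X t 0) = @nhds X t 0) : IsUnbounded t := by
  rw [ht.eq_topologyOfFilter]
  exact ht.isSolidFilter.isUnbounded h

/-- Only the elements `|y| ∧ w` of `[0, w]` matter, and there Amemiya's theorem compares `F` with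
`G`. -/
theorem IsLebesgueFilter.unboundedFilter_le {F G : Filter X} (hF : IsLebesgueFilter F)
    (hG : IsLebesgueFilter G) : unboundedFilter F ≤ unboundedFilter G := by
  intro A hA
  obtain ⟨V, hV, w, hw, h⟩ := hG.mem_unboundedFilter.1 hA
  obtain ⟨U, hU, hUV⟩ := hF.exists_Icc_subset hG hF.isArchimedean hw hV
  exact hF.mem_unboundedFilter.2 ⟨U, hU, w, hw, fun y hy =>
    h (hUV _ (le_inf (abs_nonneg y) hw) inf_le_right hy)⟩

end Unbounded

end VectorLattice

namespace VectorLattice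

open LatticeOrderedAddCommGroup (IsSolid)

/-! ### Extension along an order dense embedding -/

section ExtensionFilter

variable {X : Type u} {Y : Type v} [AddCommGroup X] [Module ℝ X]
  [AddCommGroup Y] [Lattice Y] [IsOrderedAddMonoid Y] [Module ℝ Y]

/-- The filter at zero of the extension along `j` of the unbounded modification of the topology
with neighbourhood filter `F`. -/
def extensionFilter (j : X →ₗ[ℝ] Y) (F : Filter X) : Filter Y where
  sets := {A | ∃ U ∈ F, ∃ w, 0 ≤ j w ∧ {y | ∃ x ∈ U, |y| ⊓ j w ≤ j x} ⊆ A}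
  univ_sets := ⟨univ, univ_mem, 0, by simp, subset_univ _⟩
  sets_of_superset := by
    rintro A B ⟨U, hU, w, hw, h⟩ hAB
    exact ⟨U, hU, w, hw, h.trans hAB⟩
  inter_sets := by
    rintro A B ⟨U, hU, w, hw, h⟩ ⟨U', hU', w', hw', h'⟩
    have hle : j w ≤ j (w + w') := by rw [map_add]; exact le_add_of_nonneg_right hw'
    have hle' : j w' ≤ j (w + w') := by rw [map_add]; exact le_add_of_nonneg_left hw
    refine ⟨U ∩ U', inter_mem hU hU', w + w', hw.trans hle, ?_⟩
    rintro y ⟨x, ⟨hx, hx'⟩, hy⟩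
    exact ⟨h ⟨x, hx, (inf_le_inf_left _ hle).trans hy⟩,
      h' ⟨x, hx', (inf_le_inf_left _ hle').trans hy⟩⟩

variable {j : X →ₗ[ℝ] Y} {F : Filter X}

/-- Truncation is built into the filter: truncating twice at `j w` is the same as truncating once.
-/
theorem unboundedFilter_extensionFilter (h : IsSolidFilter (extensionFilter j F)) :
    unboundedFilter (extensionFilter j F) = extensionFilter j F := by
  refine le_antisymm ?_ h.unboundedFilter_ge
  rintro A ⟨U, hU, w, hw, hA⟩
  refine h.mem_unboundedFilter.2 ⟨_, ⟨U, hU, w, hw, Subset.rfl⟩, j w, hw, ?_⟩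
  rintro y ⟨x, hx, hy⟩
  refine hA ⟨x, hx, ?_⟩
  rwa [abs_of_nonneg (le_inf (abs_nonneg y) hw), inf_assoc, inf_idem] at hy

end ExtensionFilter

section Extension

variable {X : Type u} {Y : Type v} [AddCommGroup X] [Lattice X] [Module ℝ X]
  [AddCommGroup Y] [Lattice Y] [Module ℝ Y]

/-- `j` is an isomorphism of `X` onto an order dense vector sublattice of `Y`. -/
structure IsOrderDenseEmbedding (j : X →ₗ[ℝ] Y) : Prop where
  injective : Function.Injective j
  map_sup : ∀ a b, j (a ⊔ b) = j a ⊔ j b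
  map_inf : ∀ a b, j (a ⊓ b) = j a ⊓ j b
  orderDense : ∀ y, 0 < y → ∃ x, 0 < j x ∧ j x ≤ y

theorem IsUniversalCompletion.isOrderDenseEmbedding {j : X →ₗ[ℝ] Y} (hj : IsUniversalCompletion j) :
    IsOrderDenseEmbedding j :=
  ⟨hj.injective, hj.map_sup, hj.map_inf, hj.orderDense⟩

variable (X) in
theorem IsOrderDenseEmbedding.id : IsOrderDenseEmbedding (LinearMap.id : X →ₗ[ℝ] X) :=
  ⟨Function.injective_id, fun _ _ => rfl, fun _ _ => rfl, fun y hy => ⟨y, hy, le_rfl⟩⟩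

variable {j : X →ₗ[ℝ] Y}

theorem IsOrderDenseEmbedding.le_iff (hj : IsOrderDenseEmbedding j) {a b : X} :
    j a ≤ j b ↔ a ≤ b := by
  rw [← sup_eq_right, ← hj.map_sup, hj.injective.eq_iff, sup_eq_right]

theorem IsOrderDenseEmbedding.nonneg_iff (hj : IsOrderDenseEmbedding j) {a : X} :
    0 ≤ j a ↔ 0 ≤ a := by
  rw [← map_zero j, hj.le_iff]

theorem IsOrderDenseEmbedding.map_abs (hj : IsOrderDenseEmbedding j) (a : X) :
    j |a| = |j a| := by
  rw [abs, abs, hj.map_sup, map_neg]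

theorem extends_iff {s : TopologicalSpace Y} {t : TopologicalSpace X} (hs : IsLocallySolid s)
    (ht : IsLocallySolid t) : Extends j s t ↔ @nhds X t 0 = comap j (@nhds Y s 0) := by
  constructor
  · intro h
    rw [show t = _ from h, nhds_induced, map_zero]
  · intro h
    have := hs.topologicalAddGroup
    refine IsTopologicalAddGroup.ext ht.topologicalAddGroup (topologicalAddGroup_induced j) ?_
    rw [h, nhds_induced, map_zero]

variable [IsOrderedAddMonoid Y]

/-- In effect, `c` is the infimum of its majorants from `X`. Otherwise some `0 < j x₀ ≤ (j z - c)⁺`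
could be subtracted from the majorant `w` indefinitely. -/
theorem IsOrderDenseEmbedding.map_le_of_forall_le (hj : IsOrderDenseEmbedding j)
    (hY : IsArchimedean Y) {c : Y} {w z : X} (hw : c ≤ j w) (hz : ∀ x, c ≤ j x → z ≤ x) :
    j z ≤ c := by
  by_contra hcon
  have hpos : 0 < (j z - c) ⊔ 0 := lt_of_le_of_ne le_sup_right fun h =>
    hcon (sub_nonpos.1 (le_sup_left.trans h.symm.le))
  obtain ⟨x₀, hx₀, hle⟩ := hj.orderDense _ hpos
  refine hx₀.not_ge (hY _ (j w - c) fun n => ?_)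
  suffices c ≤ j (w - n • x₀) by
    rw [map_sub, map_nsmul] at this
    rwa [le_sub_comm] at this
  induction n with
  | zero => simpa using hw
  | succ n ih =>
    have h1 : j x₀ ≤ j (w - n • x₀) - c :=
      hle.trans (sup_le (sub_le_sub_right (hj.le_iff.2 (hz _ ih)) _) (sub_nonneg.2 ih))
    rw [succ_nsmul, ← sub_sub, map_sub j _ x₀]
    rwa [le_sub_comm]

variable {F : Filter X}

/-- Order continuity is pulled back to `X`: the elements of `X` dominating some `d ∧ j w` form a
directed set, with infimum zero by `map_le_of_forall_le`. -/
theorem IsOrderDenseEmbedding.extensionFilter_exists_mem (hj : IsOrderDenseEmbedding j)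
    (hF : IsLebesgueFilter F) (hY : IsArchimedean Y) {D : Set Y} (hne : D.Nonempty)
    (hD : DirectedOn (· ≥ ·) D) (h0 : IsGLB D 0) {A : Set Y} (hA : A ∈ extensionFilter j F) :
    ∃ d ∈ D, d ∈ A := by
  obtain ⟨U, hU, w, hw, h⟩ := hA
  obtain ⟨x, ⟨d, hd, hx⟩, hxU⟩ := hF.exists_mem {x | ∃ d ∈ D, d ⊓ j w ≤ j x}
    ⟨w, hne.some, hne.some_mem, inf_le_right⟩ (by
      rintro x ⟨d, hd, hx⟩ x' ⟨d', hd', hx'⟩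
      obtain ⟨c, hc, hcd, hcd'⟩ := hD d hd d' hd'
      refine ⟨x ⊓ x', ⟨c, hc, ?_⟩, inf_le_left, inf_le_right⟩
      rw [hj.map_inf]
      exact le_inf ((inf_le_inf_right _ hcd).trans hx) ((inf_le_inf_right _ hcd').trans hx'))
    ⟨fun x ⟨d, hd, hx⟩ => hj.nonneg_iff.1 ((le_inf (h0.1 hd) hw).trans hx), fun z hz => by
      rw [← hj.le_iff, map_zero]
      refine h0.2 fun d hd => le_trans ?_ (inf_le_left (b := j w))
      exact hj.map_le_of_forall_le hY (w := w) inf_le_right fun x hx => hz ⟨d, hd, hx⟩⟩ U hU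
  exact ⟨d, hd, h ⟨x, hxU, by rwa [abs_of_nonneg (h0.1 hd)]⟩⟩

variable [IsOrderedAddMonoid X]

theorem IsOrderDenseEmbedding.isLebesgueFilter_extensionFilter [IsOrderedModule ℝ Y]
    (hj : IsOrderDenseEmbedding j) (hF : IsLebesgueFilter F) (hY : IsArchimedean Y) :
    IsLebesgueFilter (extensionFilter j F) where
  exists_solid := by
    rintro A ⟨U, hU, w, hw, h⟩
    refine ⟨_, ⟨U, hU, w, hw, Subset.rfl⟩, ?_, h⟩
    rintro y ⟨x, hx, hy⟩ y' hy'
    exact ⟨x, hx, (inf_le_inf_right _ hy').trans hy⟩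
  exists_add := by
    rintro A ⟨U, hU, w, hw, h⟩
    obtain ⟨V, hV, hVU⟩ := hF.exists_add U hU
    refine ⟨_, ⟨V, hV, w, hw, Subset.rfl⟩, ?_⟩
    rintro y ⟨x, hx, hy⟩ y' ⟨x', hx', hy'⟩
    refine h ⟨x + x', hVU x hx x' hx', ?_⟩
    rw [map_add]
    exact (inf_le_inf_right _ (abs_add_le y y')).trans <|
      (add_inf_le_inf_add_inf (abs_nonneg y) (abs_nonneg y') hw).trans (add_le_add hy hy')
  exists_smul_mem := by
    intro A hA y
    have hA' : {y | |y| ∈ A} ∈ extensionFilter j F := by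
      obtain ⟨U, hU, w, hw, h⟩ := hA
      refine ⟨U, hU, w, hw, ?_⟩
      rintro y ⟨x, hx, hy⟩
      exact h ⟨x, hx, by rwa [abs_abs]⟩
    obtain ⟨U, hU, w, hw, h⟩ := hA
    -- Absorption follows from order continuity, since the positive multiples of `|y|` decrease to
    -- zero in the Archimedean `Y`.
    let D : Set Y := {d | ∃ r : ℝ, 0 < r ∧ r • |y| = d}
    obtain ⟨_, ⟨r, hr, rfl⟩, hm⟩ := hj.extensionFilter_exists_mem hF hY (D := D)
      ⟨_, 1, one_pos, rfl⟩ (by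
        rintro _ ⟨r, hr, rfl⟩ _ ⟨r', hr', rfl⟩
        refine ⟨_, ⟨min r r', lt_min hr hr', rfl⟩, ?_, ?_⟩
        · exact smul_le_smul_of_nonneg_right (min_le_left _ _) (abs_nonneg y)
        · exact smul_le_smul_of_nonneg_right (min_le_right _ _) (abs_nonneg y))
      ⟨by rintro _ ⟨r, hr, rfl⟩; exact smul_nonneg hr.le (abs_nonneg y), fun z hz => by
        refine hY z |y| fun n => ?_
        rcases n.eq_zero_or_pos with rfl | hn
        · simp
        have hn : (0 : ℝ) < n := by exact_mod_cast hn
        have := smul_le_smul_of_nonneg_left (hz ⟨(n : ℝ)⁻¹, inv_pos.2 hn, rfl⟩) hn.le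
        rwa [smul_smul, mul_inv_cancel₀ hn.ne', one_smul, Nat.cast_smul_eq_nsmul] at this⟩
      (A := {y | ∃ x ∈ U, |y| ⊓ j w ≤ j x}) ⟨U, hU, w, hw, Subset.rfl⟩
    obtain ⟨x, hx, hle⟩ := hm
    refine ⟨r, hr, h ⟨x, hx, le_trans (inf_le_inf_right _ ?_) hle⟩⟩
    exact (abs_smul_le r y).trans (by rw [abs_of_pos hr]; exact le_abs_self _)
  exists_mem D hne hD h0 A hA := hj.extensionFilter_exists_mem hF hY hne hD h0 hA
  separated := by
    intro y hy
    by_contra hne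
    have hpos : 0 < |y| := lt_of_le_of_ne (abs_nonneg y) fun h => hne <|
      le_antisymm ((le_abs_self y).trans h.ge) (neg_nonpos.1 ((neg_le_abs y).trans h.ge))
    obtain ⟨x₀, hx₀, hle⟩ := hj.orderDense _ hpos
    have hx₀' := hj.nonneg_iff.1 hx₀.le
    refine hx₀.ne' ?_
    rw [hF.separated x₀ fun U hU => ?_, map_zero]
    obtain ⟨V, hV, hs, hVU⟩ := hF.exists_solid U hU
    obtain ⟨x, hx, h⟩ := hy _ ⟨V, hV, x₀, hx₀.le, Subset.rfl⟩
    rw [inf_eq_right.2 hle, hj.le_iff] at h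
    exact hVU (hs.mem_of_le hx hx₀' h)

theorem IsOrderDenseEmbedding.comap_extensionFilter (hj : IsOrderDenseEmbedding j)
    (hF : IsSolidFilter F) : comap j (extensionFilter j F) = unboundedFilter F := by
  ext A
  rw [hF.mem_unboundedFilter]
  constructor
  · rintro ⟨B, ⟨U, hU, w, hw, h⟩, hBA⟩
    obtain ⟨V, hV, hs, hVU⟩ := hF.exists_solid U hU
    refine ⟨V, hV, w, hj.nonneg_iff.1 hw, fun y hy => hBA (h ⟨_, hVU hy, ?_⟩)⟩
    rw [hj.map_inf, hj.map_abs]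
  · rintro ⟨U, hU, w, hw, h⟩
    obtain ⟨V, hV, hs, hVU⟩ := hF.exists_solid U hU
    refine ⟨_, ⟨V, hV, w, hj.nonneg_iff.2 hw, Subset.rfl⟩, ?_⟩
    rintro y ⟨x, hx, hy⟩
    rw [← hj.map_abs, ← hj.map_inf, hj.le_iff] at hy
    exact h (hVU (hs.mem_of_le hx (le_inf (abs_nonneg y) hw) hy))

/-- Makes the unbounded modification a special case of the extension, so its properties need no
separate proof. -/
theorem extensionFilter_id (hF : IsSolidFilter F) :
    extensionFilter (LinearMap.id : X →ₗ[ℝ] X) F = unboundedFilter F := by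
  rw [← (IsOrderDenseEmbedding.id X).comap_extensionFilter hF]
  exact comap_id.symm

theorem IsLebesgueFilter.isLebesgueFilter_unboundedFilter [IsOrderedModule ℝ X]
    (hF : IsLebesgueFilter F) : IsLebesgueFilter (unboundedFilter F) := by
  rw [← extensionFilter_id hF.toIsSolidFilter]
  exact (IsOrderDenseEmbedding.id X).isLebesgueFilter_extensionFilter hF hF.isArchimedean

theorem IsLebesgueFilter.unboundedFilter_idem [IsOrderedModule ℝ X]
    (hF : IsLebesgueFilter F) : unboundedFilter (unboundedFilter F) = unboundedFilter F := by
  have h := hF.isLebesgueFilter_unboundedFilter.toIsSolidFilter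
  rw [← extensionFilter_id hF.toIsSolidFilter] at h ⊢
  exact unboundedFilter_extensionFilter h

end Extension

/-! ### Topologies that extend to a laterally complete vector lattice -/

section Disjoint

variable {X : Type u} [AddCommGroup X] [Lattice X] [IsOrderedAddMonoid X] [Module ℝ X]
  {F : Filter X}

/-- If no neighbourhood of zero of the unbounded modification is contained in `U`, then there is a
disjoint sequence avoiding a fixed neighbourhood of zero. -/
theorem IsLebesgueFilter.exists_disjoint_seq (hF : IsLebesgueFilter F) (hX : IsArchimedean X)
    {U : Set X} (hU : U ∈ F) (h : U ∉ unboundedFilter F) :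
    ∃ V ∈ F, ∃ b : ℕ → X, (∀ n, 0 ≤ b n) ∧ Pairwise (fun m n => b m ⊓ b n = 0) ∧
      ∀ n, b n ∉ V := by
  obtain ⟨U', hU', hsolU, hsubU⟩ := hF.exists_solid U hU
  obtain ⟨s, hs, hsU⟩ := hF.exists_normalSeq hU'
  have hex : ∀ (n : ℕ) (w : X), ∃ x, 0 ≤ x ∧ x ⊓ |w| ∈ s (n + 3) ∧ x ∉ U' := by
    intro n w
    by_contra! hcon
    refine h (hF.mem_unboundedFilter.2 ⟨_, hs.mem (n + 3), |w|, abs_nonneg w, fun y hy => ?_⟩)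
    exact hsubU (hsolU.abs_mem_iff.1 (hcon _ (abs_nonneg y) hy))
  choose f hf0 hfs hfU using hex
  -- Gliding hump: `x n` avoids `U'` but is small when truncated at the sum `W n` of its
  -- predecessors.
  let W : ℕ → X := Nat.rec 0 fun n w => w + f n w
  let x : ℕ → X := fun n => f n (W n)
  have hW : ∀ n, W (n + 1) = W n + x n := fun n => rfl
  have hWmono : Monotone W := monotone_nat_of_le_succ fun n => by
    rw [hW]; exact le_add_of_nonneg_right (hf0 _ _)
  have hW0 : ∀ n, 0 ≤ W n := fun n => hWmono n.zero_le
  have hx0 : ∀ n, 0 ≤ x n := fun n => hf0 _ _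
  have hxs : ∀ n, x n ⊓ W n ∈ s (n + 3) := fun n => by
    have := hfs n (W n)
    rwa [abs_of_nonneg (hW0 n)] at this
  have hxW : ∀ {k i}, k < i → x k ≤ W i := fun {k i} hki =>
    (le_add_of_nonneg_left (hW0 k)).trans ((hW k).symm.le.trans (hWmono hki))
  -- Removing the small part `x n ∧ W n` makes the terms almost disjoint, in the sense of `hyy`.
  let y : ℕ → X := fun n => (x n - W n) ⊔ 0
  have hy0 : ∀ n, 0 ≤ y n := fun n => le_sup_right
  have hyx : ∀ n, y n ≤ x n := fun n => sup_le (sub_le_self _ (hW0 n)) (hx0 n)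
  have hxy : ∀ n, x n = x n ⊓ W n + y n := fun n => by
    have h1 : y n = (x n ⊔ W n) - W n := by rw [sup_sub, sub_self]
    rw [h1, ← add_sub_assoc, inf_add_sup, add_sub_cancel_right]
  have hyy : ∀ {k i}, k < i → ∀ m : ℕ, y k ⊓ m • y i ≤ x i ⊓ W i := fun {k i} hki m =>
    calc y k ⊓ m • y i ≤ x k ⊓ m • ((x i - x k) ⊔ 0) := by
          refine inf_le_inf (hyx k) (nsmul_le_nsmul_right ?_ m)
          exact sup_le_sup_right (sub_le_sub_left (hxW hki) _) _
      _ ≤ x i ⊓ x k := inf_nsmul_posPart_le (hx0 k) (hx0 i) m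
      _ ≤ x i ⊓ W i := inf_le_inf_left _ (hxW hki)
  have hb : ∀ k, ∃ b, 0 ≤ b ∧ b ≤ y k ∧ (∀ i, k < i → b ⊓ y i = 0) ∧ b ∉ s 3 := by
    intro k
    -- The `a n` increase towards the part of `y k` in the band of the later `y i`. In place of a
    -- band projection, `b` is a lower bound of all `y k - a n`, close to one of them.
    let a : ℕ → X := fun n => y k ⊓ n • ∑ i ∈ Finset.range n, y (k + 1 + i)
    have hS0 : ∀ n, 0 ≤ ∑ i ∈ Finset.range n, y (k + 1 + i) :=
      fun n => Finset.sum_nonneg fun i _ => hy0 _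
    have hamono : Monotone a := fun m n hmn => inf_le_inf_left _ <|
      (nsmul_le_nsmul_left (hS0 m) hmn).trans <| nsmul_le_nsmul_right
        (Finset.sum_le_sum_of_subset_of_nonneg (Finset.range_mono hmn) fun i _ _ => hy0 _) _
    have ha : ∀ n, a n ∈ s (k + 3) := fun n => by
      refine (hs.solid _).mem_of_le (hs.sum_mem hF.toIsSolidFilter (k + 3)
        (x := fun i => x (k + 1 + i) ⊓ W (k + 1 + i)) (fun i => ?_) n)
        (le_inf (hy0 k) (nsmul_nonneg (hS0 n) n)) ?_
      · rw [show k + 3 + 1 + i = k + 1 + i + 3 by ring]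
        exact hxs _
      · calc a n = y k ⊓ ∑ i ∈ Finset.range n, n • y (k + 1 + i) := by
                simp only [a, Finset.smul_sum]
          _ ≤ ∑ i ∈ Finset.range n, y k ⊓ n • y (k + 1 + i) :=
            inf_sum_le_sum_inf (fun i => nsmul_nonneg (hy0 _) n) (hy0 k) _
          _ ≤ _ := Finset.sum_le_sum fun i _ => hyy (by omega) n
    obtain ⟨_, ⟨n, rfl⟩, b, hb, hb0, hm⟩ := hF.exists_sub_lowerBounds_mem hX
      (D := range fun n => y k - a n) (range_nonempty _) (by
        rintro _ ⟨m, rfl⟩ _ ⟨n, rfl⟩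
        exact ⟨_, ⟨max m n, rfl⟩, sub_le_sub_left (hamono (le_max_left _ _)) _,
          sub_le_sub_left (hamono (le_max_right _ _)) _⟩)
      (by rintro _ ⟨n, rfl⟩; exact sub_nonneg.2 inf_le_left) (hs.mem 3)
    have hba : ∀ n, b ≤ y k - a n := fun n => hb ⟨n, rfl⟩
    have hby : b ≤ y k := (hba 0).trans (sub_le_self _ (by simp [a, hy0]))
    have hanti : Antitone s := antitone_nat_of_succ_le fun n z hz => by
      simpa using hs.add n z hz 0 (hs.zero_mem hF.toIsSolidFilter _)
    refine ⟨b, hb0, hby, fun i hi => ?_, fun hbs => ?_⟩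
    -- If `m • (b ∧ y i) ≤ y k`, it lies below some `a n`; adding `b ≤ y k - a n` gives the bound
    -- for `m + 1`.
    · refine le_antisymm (hX _ (y k) fun m => ?_) (le_inf hb0 (hy0 i))
      induction m with
      | zero => simpa using hy0 k
      | succ m ih =>
        obtain ⟨p, rfl⟩ := Nat.exists_eq_add_of_lt hi
        have h1 : m • (b ⊓ y (k + p + 1)) ≤ a (max m (p + 1)) := by
          refine le_inf ih ?_
          calc m • (b ⊓ y (k + p + 1)) ≤ m • y (k + p + 1) :=
                nsmul_le_nsmul_right inf_le_right m
            _ ≤ max m (p + 1) • y (k + p + 1) := nsmul_le_nsmul_left (hy0 _) (le_max_left _ _)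
            _ ≤ _ := nsmul_le_nsmul_right (by
              rw [add_right_comm]
              exact Finset.single_le_sum (f := fun i => y (k + 1 + i)) (fun i _ => hy0 _)
                (Finset.mem_range.2 (by omega))) _
        rw [succ_nsmul]
        calc _ ≤ a (max m (p + 1)) + (y k - a (max m (p + 1))) :=
              add_le_add h1 (inf_le_left.trans (hba _))
          _ = y k := by abel
    · refine hfU k (W k) (hsU ?_)
      -- `x k` is a sum of four elements of `s 3`; three additions lead to `s 0 ⊆ U'`, which
      -- accounts for the offset `3`.
      have h1 := hs.add 2 _ hm _ hbs
      have h2 := hs.add 1 _ h1 (a n) (hanti (by omega) (ha n))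
      have h3 := hs.add 0 _ h2 (x k ⊓ W k) (hanti (by omega) (hxs k))
      have h4 : y k - a n - b + b + a n + x k ⊓ W k = x k := by
        rw [sub_add_cancel, sub_add_cancel, add_comm]
        exact (hxy k).symm
      rwa [h4] at h3
  choose b hb0 hby hbd hbs using hb
  have hlt : ∀ {m n}, m < n → b m ⊓ b n = 0 := fun {m n} hmn => le_antisymm
    ((inf_le_inf_left _ (hby n)).trans (hbd m n hmn).le) (le_inf (hb0 m) (hb0 n))
  refine ⟨s 3, hs.mem 3, b, hb0, fun m n hmn => ?_, hbs⟩
  rcases hmn.lt_or_gt with h | h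
  · exact hlt h
  · rw [inf_comm]
    exact hlt h

/-- In a laterally complete vector lattice, disjoint sequences converge to zero for every locally
solid topology. -/
theorem IsSolidFilter.exists_mem_of_disjoint [IsOrderedModule ℝ X] (hF : IsSolidFilter F)
    (hX : IsUniversallyComplete X) {b : ℕ → X} (hb0 : ∀ n, 0 ≤ b n)
    (hb : Pairwise fun m n => b m ⊓ b n = 0) {U : Set X} (hU : U ∈ F) : ∃ n, b n ∈ U := by
  obtain ⟨V, hV, hs, hVU⟩ := hF.exists_solid U hU
  have hdis : ∀ {m n}, m ≠ n → ((m + 1) • b m) ⊓ ((n + 1) • b n) = 0 := fun {m n} hmn => by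
    refine le_antisymm ?_ (le_inf (nsmul_nonneg (hb0 m) _) (nsmul_nonneg (hb0 n) _))
    refine (inf_nsmul_le (nsmul_nonneg (hb0 m) _) (hb0 n) _).trans ?_
    have h1 := inf_nsmul_le (hb0 n) (hb0 m) (m + 1)
    rw [hb hmn.symm, nsmul_zero, inf_comm] at h1
    simpa using nsmul_le_nsmul_right h1 (n + 1)
  -- The growing multiples stay disjoint, so they have a supremum `z`; then `b n ≤ z / (n + 1)`, and
  -- neighbourhoods absorb `z`.
  obtain ⟨z, hz⟩ := hX.laterallyComplete (range fun n => (n + 1) • b n) (range_nonempty _)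
    (by rintro _ ⟨n, rfl⟩; exact nsmul_nonneg (hb0 n) _) (by
      rintro _ ⟨m, rfl⟩ _ ⟨n, rfl⟩ hmn
      exact hdis fun h => hmn (by rw [h]))
  obtain ⟨r, hr, hm⟩ := hF.exists_smul_mem V hV z
  obtain ⟨n, hn⟩ := exists_nat_one_div_lt hr
  refine ⟨n, hVU (hs.mem_of_le hm (hb0 n) ?_)⟩
  have h1 : ((n + 1 : ℕ) : ℝ) • b n ≤ z := by
    rw [Nat.cast_smul_eq_nsmul]
    exact hz.1 ⟨n, rfl⟩
  have hn0 : (0 : ℝ) < (n + 1 : ℕ) := by positivity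
  have hz0 : 0 ≤ z := (smul_nonneg hn0.le (hb0 n)).trans h1
  have h2 := smul_le_smul_of_nonneg_left h1 (inv_pos.2 hn0).le
  rw [smul_smul, inv_mul_cancel₀ hn0.ne', one_smul] at h2
  refine h2.trans (smul_le_smul_of_nonneg_right ?_ hz0)
  simpa using hn.le

/-- A disjoint sequence bounded away from zero in `X` keeps this property in `Y`, where lateral
completeness forbids it. -/
theorem IsLebesgueFilter.unboundedFilter_eq_of_comap {Y : Type v} [AddCommGroup Y] [Lattice Y]
    [IsOrderedAddMonoid Y] [Module ℝ Y] [IsOrderedModule ℝ Y] (hF : IsLebesgueFilter F)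
    (hX : IsArchimedean X) (hY : IsUniversallyComplete Y) {j : X →ₗ[ℝ] Y}
    (hj : IsOrderDenseEmbedding j) {G : Filter Y} (hG : IsSolidFilter G) (h : F = comap j G) :
    unboundedFilter F = F := by
  refine le_antisymm (fun U hU => ?_) hF.unboundedFilter_ge
  by_contra hcon
  obtain ⟨V, hV, b, hb0, hbd, hbV⟩ := hF.exists_disjoint_seq hX hU hcon
  rw [h] at hV
  obtain ⟨A, hA, hAV⟩ := hV
  obtain ⟨n, hn⟩ := hG.exists_mem_of_disjoint hY (b := fun n => j (b n))
    (fun n => hj.nonneg_iff.2 (hb0 n)) (fun m n hmn => by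
      simp only [← hj.map_inf, hbd hmn, map_zero]) hA
  exact hbV n (hAV hn)

end Disjoint

end VectorLattice

theorem theorem5p5 {X : Type u} [AddCommGroup X] [Lattice X] [IsOrderedAddMonoid X]
    [Module ℝ X] [IsOrderedModule ℝ X] :
    (∀ t₁ t₂ : TopologicalSpace X,
      VectorLattice.IsHausdorffLebesgue t₁ → VectorLattice.IsUnbounded t₁ →
      VectorLattice.IsHausdorffLebesgue t₂ → VectorLattice.IsUnbounded t₂ → t₁ = t₂) ∧
    ((∃ t : TopologicalSpace X,
        VectorLattice.IsHausdorffLebesgue t ∧ VectorLattice.IsUnbounded t) ↔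
      ∃ t : TopologicalSpace X, VectorLattice.IsHausdorffLebesgue t) ∧
    (∀ (Y : Type v) [AddCommGroup Y] [Lattice Y] [IsOrderedAddMonoid Y]
        [Module ℝ Y] [IsOrderedModule ℝ Y] (j : X →ₗ[ℝ] Y),
      VectorLattice.IsUniversalCompletion j →
      ∀ t : TopologicalSpace X, VectorLattice.IsHausdorffLebesgue t →
        (VectorLattice.IsUnbounded t ↔
          ∃ s : TopologicalSpace Y,
            VectorLattice.IsLocallySolid s ∧ VectorLattice.Extends j s t) ∧
        (VectorLattice.IsUnbounded t →
          ∃ s : TopologicalSpace Y, VectorLattice.IsHausdorffLebesgue s ∧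
            VectorLattice.IsUnbounded s ∧ VectorLattice.Extends j s t)) := by
  have uniq : ∀ t : TopologicalSpace X, VectorLattice.IsHausdorffLebesgue t →
      VectorLattice.IsUnbounded t →
      VectorLattice.unboundedFilter (@nhds X t 0) = @nhds X t 0 := fun t ht hu =>
    hu.unboundedFilter_eq
      ht.isLebesgueFilter.isLebesgueFilter_unboundedFilter.toIsSolidFilter
  have ext : ∀ (Y : Type v) [AddCommGroup Y] [Lattice Y] [IsOrderedAddMonoid Y]
      [Module ℝ Y] [IsOrderedModule ℝ Y] (j : X →ₗ[ℝ] Y), VectorLattice.IsUniversalCompletion j →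
      ∀ t : TopologicalSpace X, VectorLattice.IsHausdorffLebesgue t →
      VectorLattice.IsUnbounded t → ∃ s : TopologicalSpace Y,
        VectorLattice.IsHausdorffLebesgue s ∧ VectorLattice.IsUnbounded s ∧
          VectorLattice.Extends j s t := by
    intro Y _ _ _ _ _ j hj t ht hu
    have hF := ht.isLebesgueFilter
    have hd := hj.isOrderDenseEmbedding
    have hG := hd.isLebesgueFilter_extensionFilter hF hj.isUniversallyComplete.isArchimedean
    have hS := hG.toIsSolidFilter
    refine ⟨_, hG.isHausdorffLebesgue,
      hS.isUnbounded (VectorLattice.unboundedFilter_extensionFilter hS), ?_⟩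
    rw [VectorLattice.extends_iff hS.isLocallySolid hu.isLocallySolid,
      hS.nhds_zero_topologyOfFilter, hd.comap_extensionFilter hF.toIsSolidFilter, uniq t ht hu]
  refine ⟨fun t₁ t₂ h₁ u₁ h₂ u₂ => ?_, ⟨fun ⟨t, ht, _⟩ => ⟨t, ht⟩, fun ⟨t, ht⟩ => ?_⟩,
    fun Y _ _ _ _ _ j hj t ht => ⟨⟨fun hu => ?_, fun ⟨s, hs, he⟩ => ?_⟩, ext Y j hj t ht⟩⟩
  · refine IsTopologicalAddGroup.ext u₁.isLocallySolid.topologicalAddGroup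
      u₂.isLocallySolid.topologicalAddGroup ?_
    rw [← uniq t₁ h₁ u₁, ← uniq t₂ h₂ u₂]
    exact le_antisymm (h₁.isLebesgueFilter.unboundedFilter_le h₂.isLebesgueFilter)
      (h₂.isLebesgueFilter.unboundedFilter_le h₁.isLebesgueFilter)
  · have hF := ht.isLebesgueFilter.isLebesgueFilter_unboundedFilter
    exact ⟨_, hF.isHausdorffLebesgue,
      hF.toIsSolidFilter.isUnbounded ht.isLebesgueFilter.unboundedFilter_idem⟩
  · obtain ⟨s, hs, -, he⟩ := ext Y j hj t ht hu
    exact ⟨s, hs.isLebesgue.isLocallySolid, he⟩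
  · have hF := ht.isLebesgueFilter
    have hl := ht.isLebesgue.isLocallySolid
    exact hl.isUnbounded (hF.unboundedFilter_eq_of_comap hF.isArchimedean
      hj.isUniversallyComplete hj.isOrderDenseEmbedding hs.isSolidFilter
      ((VectorLattice.extends_iff hs hl).1 he))
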